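/- Let $G$ be a finite extensive-form game with perfect information: a finite rooted tree in which each non-terminal node $n$ is assigned to a player $i$ (the set of nodes of $i$ is $N_i$) whose moves at $n$ are the immediate successors $M_i(n)$ of $n$; put $M_i=\bigcup_{n\in N_i}M_i(n)$, and let $f_i:Z\to\mathbb R$ be the payoff function of $i$ on the set $Z$ of terminal nodes. A strategy of $i$ assigns to every $n\in N_i$ a probability distribution on $M_i(n)$. Let $G$ be played in rounds $1,2,\dots$. A valuation of player $i$ is a function $v_i:M_i\to\mathbb R$. For $\delta\in[0,1]$ the $\delta$-exploratory myopic strategy $\sigma^{v_i}_{\delta}$ of $i$ is, at each $n\in N_i$, $(1-\delta)$ times the uniform distribution on the maximizers of $v_i$ over $M_i(n)$ plus $\delta$ times the uniform distribution $\mu_i(n)$ on $M_i(n)$. By the averaging revision rule, after a history $h=(z_1,\dots,z_t)\in Z^t$ the valuation is $v_i^h$, where $v_i^h(m)=v_i(m)$ if $m$ was not reached in any round of $h$, and otherwise $v_i^h(m)$ is the average of $f_i(z_l)$ over the rounds $l\le t$ in which $m$ was reached (that is, $m$ is on the path from the root to $z_l$). Suppose that $G$ has a unique subgame perfect equilibrium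 $\beta=(\beta_i)_i$ in behavioral strategies. Then there is $\delta_0>0$, depending only on $G$, such that for every profile $v=(v_i)_i$ of initial valuations and every $0<\delta<\delta_0$ with $\delta\le 1$ the following holds. Let $P_\delta$ be the distribution on infinite histories $(z_1,z_2,\dots)\in Z^{\mathbb N}$ when, after each finite history $h$, each player $i$ plays $\sigma^{v_i^h}_\delta$ in the next round. For $P_\delta$-almost every $(z_1,z_2,\dots)$ there is $T$ such that for all $t>T$, all players $i$, all $n\in N_i$ and all $m\in M_i(n)$, $$\sigma_{\delta}^{v_i^{(z_1,\dots,z_t)}}(n)(m)=(1-\delta)\,\beta_i(n)(m)+\delta\,\mu_i(n)(m).$$ -/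

import Mathlib

open MeasureTheory ProbabilityTheory

noncomputable section

/-- A finite game in extensive form with perfect information, player set `I` and node set `V`.
`Arc n m` says that `m` is an immediate successor of `n`; the fields up to `reachable` say that
the arcs form a tree with root `root`, directed away from the root. The non-terminal nodes are
those with a successor, each is assigned to the player who moves there, and payoffs are
attached to the terminal nodes. -/
structure ExtGame (I V : Type*) where
  root : V
  Arc : V → V → Prop
  not_arc_root : ∀ n, ¬ Arc n root
  pred_unique : ∀ n n' m, Arc n m → Arc n' m → n = n'
  reachable : ∀ m, Relation.ReflTransGen Arc root m
  owner : {n : V // ∃ m, Arc n m} → I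
  payoff : I → {z : V // ¬ ∃ m, Arc z m} → ℝ

namespace ExtGame

variable {I V : Type*} (G : ExtGame I V)

/-- The non-terminal nodes (the set `N`). -/
abbrev NonTerminal : Type _ := {n : V // ∃ m, G.Arc n m}

/-- The terminal nodes (the set `Z`). -/
abbrev Terminal : Type _ := {z : V // ¬ ∃ m, G.Arc z m}

/-- The moves available at a non-terminal node: its immediate successors. -/
abbrev Move (n : G.NonTerminal) : Type _ := {m : V // G.Arc n.1 m}

instance (n : G.NonTerminal) : Nonempty (G.Move n) := ⟨⟨n.2.choose, n.2.choose_spec⟩⟩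

/-- The nodes of player `i` (the set `N_i`). -/
abbrev NodeOf (i : I) : Type _ := {n : G.NonTerminal // G.owner n = i}

/-- The moves of player `i` at all of the nodes of `i` (the set `M_i`). -/
abbrev MoveOf (i : I) : Type _ := {m : V // ∃ n : G.NodeOf i, G.Arc n.1.1 m}

/-- A behavioral strategy of player `i`. -/
abbrev Strategy (i : I) : Type _ := (n : G.NodeOf i) → PMF (G.Move n.1)

/-- A profile of behavioral strategies. -/
abbrev Profile : Type _ := (i : I) → G.Strategy i

/-- `G.OnPath m z`: the node `m` is on the path from the root to the node `z`. -/
def OnPath (m z : V) : Prop := Relation.ReflTransGen G.Arc m z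

theorem acyclic (m : V) : ¬ Relation.TransGen G.Arc m m := by
  induction G.reachable m with
  | refl =>
    intro h
    obtain ⟨b, -, hb⟩ := Relation.TransGen.tail'_iff.1 h
    exact G.not_arc_root _ hb
  | @tail n m _ hnm ih =>
    intro h
    obtain ⟨b, hmb, hb⟩ := Relation.TransGen.tail'_iff.1 h
    obtain rfl := G.pred_unique _ _ _ hb hnm
    exact ih (Relation.TransGen.head' hnm hmb)

theorem wellFounded_arc [Finite V] : WellFounded (fun m n => G.Arc n m) := by
  have : IsTrans V (fun m n => Relation.TransGen G.Arc n m) := ⟨fun _ _ _ h h' => h'.trans h⟩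
  have : Std.Irrefl (fun m n => Relation.TransGen G.Arc n m) := ⟨G.acyclic⟩
  exact Subrelation.wf (fun h => Relation.TransGen.single h)
    (Finite.wellFounded_of_trans_of_irrefl (fun m n => Relation.TransGen G.Arc n m))

open Classical in
/-- The distribution of the terminal node reached when the profile `σ` is played from node `n`
on, that is, in the subgame starting at `n`. -/
def outcome [Finite V] (σ : G.Profile) : V → PMF G.Terminal :=
  G.wellFounded_arc.fix fun n rec =>
    if h : ∃ m, G.Arc n m then
      (σ (G.owner ⟨n, h⟩) ⟨⟨n, h⟩, rfl⟩).bind fun m => rec m.1 m.2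
    else PMF.pure ⟨n, h⟩

open Classical in
/-- The expected payoff of player `i` in the subgame starting at `n`. -/
def expectedPayoff [Fintype V] (σ : G.Profile) (i : I) (n : V) : ℝ :=
  ∑ z : G.Terminal, (G.outcome σ n z).toReal * G.payoff i z

open Classical in
/-- `σ` is a (subgame) perfect equilibrium: in the subgame starting at any node, no player
can gain by a unilateral deviation. -/
def IsPerfectEquilibrium [Fintype V] (σ : G.Profile) : Prop :=
  ∀ (n : V) (i : I) (τ : G.Strategy i),
    G.expectedPayoff (Function.update σ i τ) i n ≤ G.expectedPayoff σ i n

/-! ### The repeated game -/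

/-- A super strategy of player `i`: after each finite history of terminal nodes, a strategy for
the next round. -/
abbrev SuperStrategy (i : I) : Type _ := List G.Terminal → G.Strategy i

instance : MeasurableSpace G.Terminal := ⊤

instance : DiscreteMeasurableSpace G.Terminal := ⟨fun _ => trivial⟩

/-- The distribution of the next terminal node after the history `h`. -/
def roundLaw [Finite V] (S : (i : I) → G.SuperStrategy i) (h : List G.Terminal) :
    Measure G.Terminal :=
  (G.outcome (fun i => S i h) G.root).toMeasure

instance [Finite V] (S : (i : I) → G.SuperStrategy i) (h : List G.Terminal) :
    IsProbabilityMeasure (G.roundLaw S h) := by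
  unfold roundLaw; infer_instance

/-- The transition kernel from the first `t + 1` rounds to the following round. -/
def roundKernel [Finite V] (S : (i : I) → G.SuperStrategy i) (t : ℕ) :
    Kernel ((_ : Finset.Iic t) → G.Terminal) G.Terminal :=
  Kernel.ofFunOfCountable fun h =>
    G.roundLaw S (List.ofFn fun k : Fin (t + 1) =>
      h ⟨k.1, Finset.mem_Iic.2 (Nat.lt_succ_iff.1 k.2)⟩)

instance [Finite V] (S : (i : I) → G.SuperStrategy i) (t : ℕ) :
    IsMarkovKernel (G.roundKernel S t) :=
  ⟨fun h => by unfold roundKernel; simp only [Kernel.ofFunOfCountable]; exact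
    inferInstanceAs (IsProbabilityMeasure (G.roundLaw S _))⟩

/-- The distribution over infinite histories induced by a profile of super strategies. The
terminal node of round `t + 1` of the history `ω` is `ω t`. -/
def superPlay [Finite V] (S : (i : I) → G.SuperStrategy i) : Measure (ℕ → G.Terminal) :=
  Kernel.trajMeasure (X := fun _ => G.Terminal) (G.roundLaw S []) (G.roundKernel S)

/-- The history of the first `t` rounds of an infinite history. -/
def firstRounds {G : ExtGame I V} (ω : ℕ → G.Terminal) (t : ℕ) : List G.Terminal :=
  List.ofFn fun k : Fin t => ω k

/-! ### Playing by valuation -/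

/-- A valuation for player `i`. -/
abbrev Valuation (i : I) : Type _ := G.MoveOf i → ℝ

/-- The valuation of a move at a given node of player `i`. -/
def Valuation.at {G : ExtGame I V} {i : I} (v : G.Valuation i) (n : G.NodeOf i)
    (m : G.Move n.1) : ℝ :=
  v ⟨m.1, n, m.2⟩

open Classical in
/-- The strategy that selects uniformly one of the moves at each node. -/
def uniformStrategy [Fintype V] (i : I) : G.Strategy i :=
  fun n => PMF.uniformOfFintype (G.Move n.1)

open Classical in
/-- The myopic strategy rule: at each node, uniform over the maximizers of the valuation. -/
def myopic [Fintype V] {i : I} (v : G.Valuation i) : G.Strategy i := fun n =>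
  PMF.uniformOfFinset
    (Finset.univ.filter fun m : G.Move n.1 => ∀ m' : G.Move n.1, v.at n m' ≤ v.at n m)
    (by
      obtain ⟨m, hm⟩ := Finite.exists_max (v.at n)
      exact ⟨m, by simpa using hm⟩)

/-- The mixture `(1 - δ) p + δ q` of two probability distributions. -/
def mix {α : Type*} (δ : unitInterval) (p q : PMF α) : PMF α :=
  ⟨fun a => ENNReal.ofReal (1 - δ) * p a + ENNReal.ofReal δ * q a, by
    have h : ENNReal.ofReal (1 - δ) * 1 + ENNReal.ofReal δ * 1 = 1 := by
      rw [mul_one, mul_one, ← ENNReal.ofReal_add (by linarith [δ.2.2]) δ.2.1]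
      simp
    have hs := ENNReal.summable (f := fun a =>
      ENNReal.ofReal (1 - δ) * p a + ENNReal.ofReal δ * q a)
    have ht : ∑' a, (ENNReal.ofReal (1 - δ) * p a + ENNReal.ofReal δ * q a) = 1 := by
      rw [ENNReal.tsum_add, ENNReal.tsum_mul_left, ENNReal.tsum_mul_left, p.tsum_coe,
        q.tsum_coe, h]
    exact ht ▸ hs.hasSum⟩

/-- The `δ`-exploratory myopic strategy rule. -/
def exploratory [Fintype V] (δ : unitInterval) {i : I} (v : G.Valuation i) : G.Strategy i :=
  fun n => mix δ (G.myopic v n) (G.uniformStrategy i n)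

open Classical in
/-- The averaging revision rule: a move that was never reached in `h` keeps its valuation, any
other move gets the average payoff over the rounds of `h` in which it was reached. -/
def averaging {i : I} (v : G.Valuation i) (h : List G.Terminal) : G.Valuation i := fun m =>
  let visits := h.filter fun z => G.OnPath m.1 z.1
  if visits = [] then v m else (visits.map (G.payoff i)).sum / visits.length

/-- The valuation super strategy induced by the `δ`-exploratory myopic strategy rule, the
averaging revision rule and the initial valuation `v`. -/
def valuationSuperStrategy [Fintype V] (δ : unitInterval) {i : I} (v : G.Valuation i) :
    G.SuperStrategy i :=
  fun h => G.exploratory δ (G.averaging v h)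

end ExtGame

end

/-! Uniqueness makes every choice strict. Backward induction can place any payoff-maximizing move at
a node into some perfect equilibrium, so two maximizers would give two equilibria. Hence `β` plays
at each node one move that is strictly best against `β` itself (`exists_strict_max_of_unique`).
Expected payoffs under `explore δ β` are continuous in `δ` and there are finitely many moves, so
strictness survives for all `δ` below some `δ₀` that depends only on the game
(`exists_forall_expectedPayoff_explore_lt`).

Fix such a `δ > 0`. Every move always has probability at least `δ / |V|`, so almost surely every
node is reached infinitely often (`ae_tendsto_visitCount_onPath`). In the rounds that reach `m`,
payoff minus current continuation payoff at `m` is a bounded martingale difference. Dividing each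
increment by the running number of visits gives an L²-bounded martingale, which converges, and
Kronecker's lemma turns this into a law of large numbers along the visits (`ae_tendsto_average`).

The rest is deterministic, along one good history, by induction from the terminal nodes
(`eventually_localStrategy_eq`). Once play below a node agrees with `explore δ β`, continuation
payoffs of its moves are constant, so the averages converge to them. These limits are strictly
ordered, so from some round on the best move is the only maximizer, and play at the node agrees with
`explore δ β` exactly. -/

noncomputable section

namespace ExtGame

open scoped Classical

variable {I V : Type*} (G : ExtGame I V)

/-! ### Profiles as families of local strategies -/

/-- The local strategies, at all non-terminal nodes, of a profile. -/
def localStrategy {G : ExtGame I V} (σ : G.Profile) (n : G.NonTerminal) : PMF (G.Move n) :=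
  σ (G.owner n) ⟨n, rfl⟩

/-- The profile with given local strategies. -/
def ofLocal (s : (n : G.NonTerminal) → PMF (G.Move n)) : G.Profile := fun _ n => s n.1

theorem localStrategy_ofLocal (s : (n : G.NonTerminal) → PMF (G.Move n)) (n : G.NonTerminal) :
    localStrategy (G.ofLocal s) n = s n := rfl

/-- The profile in which the local strategy at `n` is replaced by `p`. -/
def updateLocal (σ : G.Profile) (n : G.NonTerminal) (p : PMF (G.Move n)) : G.Profile :=
  G.ofLocal (Function.update (localStrategy σ) n p)

theorem localStrategy_updateLocal_self (σ : G.Profile) (n : G.NonTerminal)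
    (p : PMF (G.Move n)) : localStrategy (G.updateLocal σ n p) n = p := by
  simp [updateLocal, localStrategy_ofLocal]

theorem localStrategy_updateLocal_of_ne (σ : G.Profile) {n k : G.NonTerminal} (h : k ≠ n)
    (p : PMF (G.Move n)) : localStrategy (G.updateLocal σ n p) k = localStrategy σ k := by
  simp [updateLocal, localStrategy_ofLocal, h]

/-! ### Paths -/

theorem not_reflTransGen_of_arc {n m : V} (h : G.Arc n m) :
    ¬ Relation.ReflTransGen G.Arc m n :=
  fun h' => G.acyclic n (Relation.TransGen.head' h h')

theorem reflTransGen_total {a b z : V} (ha : Relation.ReflTransGen G.Arc a z)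
    (hb : Relation.ReflTransGen G.Arc b z) :
    Relation.ReflTransGen G.Arc a b ∨ Relation.ReflTransGen G.Arc b a := by
  induction ha with
  | refl => exact Or.inr hb
  | @tail y z hay hyz ih =>
    rcases Relation.ReflTransGen.cases_tail hb with rfl | ⟨y', hby', hy'z⟩
    · exact Or.inl (hay.tail hyz)
    · obtain rfl := G.pred_unique _ _ _ hyz hy'z
      exact ih hby'

/-- The nodes above `z` form a chain, so one sibling would lie above the other; a strict descent
would pass through the common predecessor `n` and close a cycle. -/
theorem eq_of_arc_of_onPath {n a b z : V} (ha : G.Arc n a) (hb : G.Arc n b)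
    (haz : G.OnPath a z) (hbz : G.OnPath b z) : a = b := by
  have key : ∀ {a b : V}, G.Arc n a → G.Arc n b → Relation.ReflTransGen G.Arc a b → a = b := by
    intro a b ha hb hab
    rcases Relation.ReflTransGen.cases_tail hab with rfl | ⟨y, hay, hyb⟩
    · rfl
    · obtain rfl := G.pred_unique _ _ _ hb hyb
      exact absurd hay (G.not_reflTransGen_of_arc ha)
  rcases G.reflTransGen_total haz hbz with h | h
  · exact key ha hb h
  · exact (key hb ha h).symm

/-! ### Outcomes and expected payoffs -/

section Outcome

variable [Fintype V]

theorem outcome_nonTerminal (σ : G.Profile) (n : G.NonTerminal) :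
    G.outcome σ n.1 = (localStrategy σ n).bind fun m => G.outcome σ m.1 := by
  conv_lhs => rw [outcome, WellFounded.fix_eq, dif_pos n.2]
  rfl

theorem outcome_terminal (σ : G.Profile) (z : G.Terminal) : G.outcome σ z.1 = PMF.pure z := by
  rw [outcome, WellFounded.fix_eq, dif_neg z.2]

/-- The probability that the terminal node `z` is reached from the node `n`. -/
def outcomeProb (σ : G.Profile) (n : V) (z : G.Terminal) : ℝ := (G.outcome σ n z).toReal

theorem outcomeProb_nonneg (σ : G.Profile) (n : V) (z : G.Terminal) :
    0 ≤ G.outcomeProb σ n z := ENNReal.toReal_nonneg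

theorem outcomeProb_le_one (σ : G.Profile) (n : V) (z : G.Terminal) :
    G.outcomeProb σ n z ≤ 1 :=
  ENNReal.toReal_le_of_le_ofReal zero_le_one (by simpa using PMF.coe_le_one _ _)

theorem _root_.PMF.sum_toReal {α : Type*} [Fintype α] (p : PMF α) :
    ∑ a, (p a).toReal = 1 := by
  rw [← ENNReal.toReal_sum fun a _ => p.apply_ne_top a, ← tsum_fintype (L := .unconditional _),
    p.tsum_coe, ENNReal.toReal_one]

theorem _root_.PMF.bind_apply_toReal {α β : Type*} [Fintype α] (p : PMF α) (f : α → PMF β)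
    (b : β) : (p.bind f b).toReal = ∑ a, (p a).toReal * (f a b).toReal := by
  rw [PMF.bind_apply, tsum_fintype, ENNReal.toReal_sum]
  · simp
  · exact fun a _ => ENNReal.mul_ne_top (p.apply_ne_top a) ((f a).apply_ne_top b)

theorem sum_outcomeProb (σ : G.Profile) (n : V) : ∑ z, G.outcomeProb σ n z = 1 :=
  PMF.sum_toReal _

theorem outcomeProb_nonTerminal (σ : G.Profile) (n : G.NonTerminal) (z : G.Terminal) :
    G.outcomeProb σ n.1 z =
      ∑ m : G.Move n, (localStrategy σ n m).toReal * G.outcomeProb σ m.1 z := by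
  rw [outcomeProb, outcome_nonTerminal, PMF.bind_apply_toReal]
  rfl

theorem expectedPayoff_eq_sum (σ : G.Profile) (i : I) (n : V) :
    G.expectedPayoff σ i n = ∑ z, G.outcomeProb σ n z * G.payoff i z := rfl

theorem expectedPayoff_nonTerminal (σ : G.Profile) (i : I) (n : G.NonTerminal) :
    G.expectedPayoff σ i n.1 =
      ∑ m : G.Move n, (localStrategy σ n m).toReal * G.expectedPayoff σ i m.1 := by
  simp_rw [expectedPayoff_eq_sum, outcomeProb_nonTerminal, Finset.sum_mul, Finset.mul_sum]
  rw [Finset.sum_comm]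
  simp_rw [mul_assoc]

theorem expectedPayoff_terminal (σ : G.Profile) (i : I) (z : G.Terminal) :
    G.expectedPayoff σ i z.1 = G.payoff i z := by
  rw [expectedPayoff_eq_sum, Finset.sum_eq_single z]
  · simp [outcomeProb, outcome_terminal]
  · intro b _ hb
    simp [outcomeProb, outcome_terminal, hb]
  · simp

theorem abs_expectedPayoff_le (σ : G.Profile) (i : I) (n : V) :
    |G.expectedPayoff σ i n| ≤ ∑ z, |G.payoff i z| := by
  rw [expectedPayoff_eq_sum]
  refine (Finset.abs_sum_le_sum_abs _ _).trans (Finset.sum_le_sum fun z _ => ?_)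
  rw [abs_mul, abs_of_nonneg (G.outcomeProb_nonneg σ n z)]
  exact mul_le_of_le_one_left (abs_nonneg _) (G.outcomeProb_le_one σ n z)

/-- Induction from the terminal nodes towards the root. -/
theorem backward_induction {p : V → Prop} (terminal : ∀ z : G.Terminal, p z.1)
    (nonTerminal : ∀ n : G.NonTerminal, (∀ m : G.Move n, p m.1) → p n.1) (n : V) : p n := by
  induction n using G.wellFounded_arc.induction with
  | _ n ih =>
    by_cases h : ∃ m, G.Arc n m
    · exact nonTerminal ⟨n, h⟩ fun m => ih m.1 m.2
    · exact terminal ⟨n, h⟩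

theorem outcome_congr {σ σ' : G.Profile} (m : V)
    (h : ∀ n : G.NonTerminal, G.OnPath m n.1 → localStrategy σ n = localStrategy σ' n) :
    G.outcome σ m = G.outcome σ' m := by
  induction m using G.backward_induction with
  | terminal z => rw [outcome_terminal, outcome_terminal]
  | nonTerminal n ih =>
    rw [outcome_nonTerminal, outcome_nonTerminal, h n .refl]
    congr 1
    funext m
    exact ih m fun k hk => h k (hk.head m.2)

theorem expectedPayoff_congr {σ σ' : G.Profile} (i : I) (m : V)
    (h : ∀ n : G.NonTerminal, G.OnPath m n.1 → localStrategy σ n = localStrategy σ' n) :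
    G.expectedPayoff σ i m = G.expectedPayoff σ' i m := by
  rw [expectedPayoff, expectedPayoff, G.outcome_congr m h]

theorem expectedPayoff_updateLocal (σ : G.Profile) (n : G.NonTerminal) (p : PMF (G.Move n))
    (i : I) {k : V} (h : ¬ G.OnPath k n.1) :
    G.expectedPayoff (G.updateLocal σ n p) i k = G.expectedPayoff σ i k :=
  G.expectedPayoff_congr i k fun l hl =>
    G.localStrategy_updateLocal_of_ne σ (by rintro rfl; exact h hl) p

theorem outcomeProb_eq_zero (σ : G.Profile) {m : V} {z : G.Terminal} (h : ¬ G.OnPath m z.1) :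
    G.outcomeProb σ m z = 0 := by
  induction m using G.backward_induction with
  | terminal z' =>
    have : z ≠ z' := by rintro rfl; exact h .refl
    simp [outcomeProb, outcome_terminal, this]
  | nonTerminal n ih =>
    rw [outcomeProb_nonTerminal]
    exact Finset.sum_eq_zero fun m _ => by rw [ih m fun hm => h (hm.head m.2), mul_zero]

/-- Conditionally on reaching `m`, the outcome is that of the subgame at `m`; the probability of
reaching `m` is bounded below in terms of the least probability of a move. -/
theorem exists_outcomeProb_eq_mul {n m : V} (h : G.OnPath n m) :
    ∃ k : ℕ, ∀ σ : G.Profile, ∃ r : ℝ,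
      (∀ z : G.Terminal, G.OnPath m z.1 → G.outcomeProb σ n z = r * G.outcomeProb σ m z) ∧
      ∀ ε : ℝ, 0 ≤ ε → (∀ (l : G.NonTerminal) (a : G.Move l), ε ≤ (localStrategy σ l a).toReal) →
        ε ^ k ≤ r := by
  induction h using Relation.ReflTransGen.head_induction_on with
  | refl => exact ⟨0, fun σ => ⟨1, fun z _ => (one_mul _).symm, fun ε _ _ => by simp⟩⟩
  | @head n n' hn hm ih =>
    obtain ⟨k, hk⟩ := ih
    refine ⟨k + 1, fun σ => ?_⟩
    obtain ⟨r, hr, hr'⟩ := hk σ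
    let N : G.NonTerminal := ⟨n, n', hn⟩
    let a : G.Move N := ⟨n', hn⟩
    refine ⟨(localStrategy σ N a).toReal * r, fun z hz => ?_, fun ε hε hl => ?_⟩
    · change G.outcomeProb σ N.1 z = _
      -- Only one move at `n` can lead to `z`, so the recursion has a single nonzero term.
      rw [outcomeProb_nonTerminal, Finset.sum_eq_single a, hr z hz, mul_assoc]
      · intro b _ hb
        rw [outcomeProb_eq_zero, mul_zero]
        intro hbz
        exact hb (Subtype.ext (G.eq_of_arc_of_onPath b.2 hn hbz (hm.trans hz)))
      · simp
    · rw [pow_succ']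
      exact mul_le_mul (hl N a) (hr' ε hε hl) (pow_nonneg hε k) ENNReal.toReal_nonneg

/-- Given that `m` is reached, the mean payoff is the continuation payoff at `m`. Since this holds
for every profile, it holds for the one played after any history, which supplies the martingale
differences. -/
theorem sum_outcomeProb_mul_sub_expectedPayoff (σ : G.Profile) (i : I) (m : V) :
    ∑ z, G.outcomeProb σ G.root z *
      (if G.OnPath m z.1 then G.payoff i z - G.expectedPayoff σ i m else 0) = 0 := by
  obtain ⟨k, hk⟩ := G.exists_outcomeProb_eq_mul (G.reachable m)
  obtain ⟨r, hr, -⟩ := hk σ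
  have key : ∀ z : G.Terminal, G.outcomeProb σ G.root z *
      (if G.OnPath m z.1 then G.payoff i z - G.expectedPayoff σ i m else 0) =
      r * (G.outcomeProb σ m z * G.payoff i z) -
        r * G.expectedPayoff σ i m * G.outcomeProb σ m z := by
    intro z
    split_ifs with hz
    · rw [hr z hz]; ring
    · rw [G.outcomeProb_eq_zero σ hz]; ring
  simp_rw [key, Finset.sum_sub_distrib, ← Finset.mul_sum, G.sum_outcomeProb]
  rw [← expectedPayoff_eq_sum]
  ring

/-- The exponent is chosen before the profile, so the bound is uniform over all histories. -/
theorem exists_pow_le_sum_outcomeProb (m : V) : ∃ k : ℕ, ∀ (σ : G.Profile) (ε : ℝ), 0 ≤ ε →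
    (∀ (l : G.NonTerminal) (a : G.Move l), ε ≤ (localStrategy σ l a).toReal) →
    ε ^ k ≤ ∑ z, G.outcomeProb σ G.root z * (if G.OnPath m z.1 then 1 else 0) := by
  obtain ⟨k, hk⟩ := G.exists_outcomeProb_eq_mul (G.reachable m)
  refine ⟨k, fun σ ε hε hl => ?_⟩
  obtain ⟨r, hr, hr'⟩ := hk σ
  refine (hr' ε hε hl).trans_eq ?_
  have key : ∀ z : G.Terminal, G.outcomeProb σ G.root z * (if G.OnPath m z.1 then 1 else 0) =
      r * G.outcomeProb σ m z := by
    intro z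
    split_ifs with hz
    · rw [hr z hz, mul_one]
    · rw [G.outcomeProb_eq_zero σ hz]; ring
  simp_rw [key, ← Finset.mul_sum, G.sum_outcomeProb, mul_one]

/-! ### Perfect equilibria -/

/-- No move at `n` is better for its owner than following `σ`. -/
def IsOneShotOptimal (σ : G.Profile) (n : G.NonTerminal) : Prop :=
  ∀ m : G.Move n, G.expectedPayoff σ (G.owner n) m.1 ≤ G.expectedPayoff σ (G.owner n) n.1

/-- The one-shot deviation principle. -/
theorem isPerfectEquilibrium_of_isOneShotOptimal {σ : G.Profile}
    (h : ∀ n, G.IsOneShotOptimal σ n) : G.IsPerfectEquilibrium σ := by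
  intro n i τ
  induction n using G.backward_induction with
  | terminal z => rw [expectedPayoff_terminal, expectedPayoff_terminal]
  | nonTerminal n ih =>
    by_cases hi : G.owner n = i
    · subst hi
      rw [expectedPayoff_nonTerminal]
      calc _ ≤ ∑ m : G.Move n, (localStrategy (Function.update σ (G.owner n) τ) n m).toReal *
            G.expectedPayoff σ (G.owner n) n.1 :=
            Finset.sum_le_sum fun m _ =>
              mul_le_mul_of_nonneg_left ((ih m).trans (h n m)) ENNReal.toReal_nonneg
        _ = _ := by rw [← Finset.sum_mul, PMF.sum_toReal, one_mul]
    · rw [expectedPayoff_nonTerminal, expectedPayoff_nonTerminal]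
      have : localStrategy (Function.update σ i τ) n = localStrategy σ n := by
        simp [localStrategy, Function.update_of_ne hi]
      rw [this]
      exact Finset.sum_le_sum fun m _ => mul_le_mul_of_nonneg_left (ih m) ENNReal.toReal_nonneg

theorem expectedPayoff_of_localStrategy_eq_pure {σ : G.Profile} {n : G.NonTerminal}
    {m : G.Move n} (h : localStrategy σ n = PMF.pure m) (i : I) :
    G.expectedPayoff σ i n.1 = G.expectedPayoff σ i m.1 := by
  rw [expectedPayoff_nonTerminal, h, Finset.sum_eq_single m]
  · simp
  · intro b _ hb
    simp [PMF.pure_apply, hb]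
  · simp

/-- Changing play at `n` leaves the subgames after the moves at `n` untouched, so the comparison of
moves is the one made under `σ`. -/
theorem isOneShotOptimal_updateLocal_pure {σ : G.Profile} {n : G.NonTerminal} {m : G.Move n}
    (hm : ∀ m' : G.Move n,
      G.expectedPayoff σ (G.owner n) m'.1 ≤ G.expectedPayoff σ (G.owner n) m.1) :
    G.IsOneShotOptimal (G.updateLocal σ n (PMF.pure m)) n := by
  intro m'
  rw [G.expectedPayoff_of_localStrategy_eq_pure (G.localStrategy_updateLocal_self σ n _),
    G.expectedPayoff_updateLocal _ _ _ _ (G.not_reflTransGen_of_arc m.2),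
    G.expectedPayoff_updateLocal _ _ _ _ (G.not_reflTransGen_of_arc m'.2)]
  exact hm m'

theorem IsOneShotOptimal.updateLocal {σ : G.Profile} {k n : G.NonTerminal}
    (hk : G.IsOneShotOptimal σ k) (h : ¬ G.OnPath k.1 n.1) (p : PMF (G.Move n)) :
    G.IsOneShotOptimal (G.updateLocal σ n p) k := by
  intro m
  rw [G.expectedPayoff_updateLocal _ _ _ _ h,
    G.expectedPayoff_updateLocal _ _ _ _ fun hm => h (Relation.ReflTransGen.head m.2 hm)]
  exact hk m

/-- Backward induction: a profile that is one-shot optimal on a set of nodes closed under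
successors can be changed outside this set to be one-shot optimal everywhere. -/
theorem exists_isOneShotOptimal_extension (S : Set G.NonTerminal)
    (hS : ∀ k ∈ S, ∀ l : G.NonTerminal, G.OnPath k.1 l.1 → l ∈ S) (σ : G.Profile)
    (hσ : ∀ k ∈ S, G.IsOneShotOptimal σ k) :
    ∃ σ' : G.Profile, (∀ k ∈ S, localStrategy σ' k = localStrategy σ k) ∧
      ∀ n, G.IsOneShotOptimal σ' n := by
  induction hc : Sᶜ.ncard using Nat.strong_induction_on generalizing S σ with
  | _ c ih =>
    by_cases hU : S = Set.univ
    · exact ⟨σ, fun _ _ => rfl, fun n => hσ n (hU ▸ Set.mem_univ n)⟩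
    -- A lowest node outside `S`: everything strictly below it already lies in `S`, so adding `n`
    -- keeps the set closed under successors.
    obtain ⟨n, hn, hmin⟩ := (InvImage.wf (fun n : G.NonTerminal => n.1)
      G.wellFounded_arc).has_min Sᶜ (Set.nonempty_compl.2 hU)
    have hsucc : ∀ l : G.NonTerminal, G.OnPath n.1 l.1 → l = n ∨ l ∈ S := by
      intro l hl
      rcases Relation.ReflTransGen.cases_head hl with h | ⟨m, hnm, hml⟩
      · exact Or.inl (Subtype.ext h.symm)
      · right
        have hm : ∃ m', G.Arc m m' := by
          rcases Relation.ReflTransGen.cases_head hml with rfl | ⟨m', hm', -⟩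
          · exact l.2
          · exact ⟨m', hm'⟩
        by_contra hlS
        exact hmin ⟨m, hm⟩ (fun hmS => hlS (hS _ hmS l hml)) hnm
    obtain ⟨m, hm⟩ := Finite.exists_max
      fun m : G.Move n => G.expectedPayoff σ (G.owner n) m.1
    obtain ⟨σ', h1, h2⟩ := ih (insert n S)ᶜ.ncard (by
        rw [← hc]
        refine Set.ncard_lt_ncard ?_ (Set.toFinite _)
        exact compl_lt_compl_iff_lt.2 (Set.ssubset_insert hn))
      (insert n S) (by
        rintro k (rfl | hk) l hl
        · exact hsucc l hl
        · exact Or.inr (hS k hk l hl))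
      (G.updateLocal σ n (PMF.pure m)) (by
        rintro k (rfl | hk)
        · exact G.isOneShotOptimal_updateLocal_pure hm
        · exact (hσ k hk).updateLocal G (fun h => hn (hS k hk n h)) _) rfl
    refine ⟨σ', fun k hk => ?_, h2⟩
    rw [h1 k (Or.inr hk), G.localStrategy_updateLocal_of_ne]
    rintro rfl
    exact hn hk

/-- A unique perfect equilibrium selects at each node a move that is strictly best. -/
theorem exists_strict_max_of_unique {β : G.Profile}
    (hu : ∀ β' : G.Profile, G.IsPerfectEquilibrium β' → β' = β) (n : G.NonTerminal) :
    ∃ m : G.Move n, localStrategy β n = PMF.pure m ∧ ∀ m' : G.Move n, m' ≠ m →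
      G.expectedPayoff β (G.owner n) m'.1 < G.expectedPayoff β (G.owner n) m.1 := by
  -- Extending from the empty set produces a profile that is optimal everywhere; uniqueness
  -- identifies it with `β`, so no converse of the one-shot deviation principle is needed.
  have hopt : ∀ k, G.IsOneShotOptimal β k := by
    obtain ⟨β', -, h⟩ := G.exists_isOneShotOptimal_extension ∅ (by simp) β (by simp)
    rwa [← hu β' (G.isPerfectEquilibrium_of_isOneShotOptimal h)]
  have key : ∀ m : G.Move n, (∀ m' : G.Move n,
      G.expectedPayoff β (G.owner n) m'.1 ≤ G.expectedPayoff β (G.owner n) m.1) →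
      localStrategy β n = PMF.pure m := by
    intro m hm
    -- Freeze the subgame at `n` with `m` played there and repair only the nodes outside; the result
    -- is an equilibrium, hence `β`.
    obtain ⟨β', h1, h2⟩ := G.exists_isOneShotOptimal_extension {k | G.OnPath n.1 k.1}
      (fun k hk l hl => Relation.ReflTransGen.trans hk hl) (G.updateLocal β n (PMF.pure m)) (by
        intro k hk
        by_cases hkn : k = n
        · subst hkn
          exact G.isOneShotOptimal_updateLocal_pure hm
        · refine (hopt k).updateLocal G (fun h => ?_) _
          rcases Relation.ReflTransGen.cases_head hk with h' | ⟨l, hl, hlk⟩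
          · exact hkn (Subtype.ext h'.symm)
          · exact G.not_reflTransGen_of_arc hl (hlk.trans h))
    rw [← hu β' (G.isPerfectEquilibrium_of_isOneShotOptimal h2), h1 n .refl,
      localStrategy_updateLocal_self]
  obtain ⟨m, hm⟩ := Finite.exists_max fun m : G.Move n => G.expectedPayoff β (G.owner n) m.1
  refine ⟨m, key m hm, fun m' hne => lt_of_le_of_ne (hm m') fun he => hne ?_⟩
  have h := (key m' fun m'' => (hm m'').trans_eq he.symm).symm.trans (key m hm)
  by_contra hmm
  have h' := congrArg (fun p : PMF (G.Move n) => p m') h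
  simp [PMF.pure_apply, hmm] at h'

/-! ### Exploration -/

theorem mix_apply_toReal {α : Type*} (δ : unitInterval) (p q : PMF α) (a : α) :
    (mix δ p q a).toReal = (1 - (δ : ℝ)) * (p a).toReal + (δ : ℝ) * (q a).toReal := by
  change (ENNReal.ofReal (1 - δ) * p a + ENNReal.ofReal δ * q a).toReal = _
  rw [ENNReal.toReal_add (ENNReal.mul_ne_top ENNReal.ofReal_ne_top (p.apply_ne_top a))
    (ENNReal.mul_ne_top ENNReal.ofReal_ne_top (q.apply_ne_top a)), ENNReal.toReal_mul,
    ENNReal.toReal_mul, ENNReal.toReal_ofReal (by linarith [δ.2.2]), ENNReal.toReal_ofReal δ.2.1]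

/-- The profile `(1 - δ) σ + δ μ`, where `μ` is the uniform profile. -/
def explore (δ : unitInterval) (σ : G.Profile) : G.Profile :=
  fun i n => mix δ (σ i n) (G.uniformStrategy i n)

theorem localStrategy_explore_toReal (δ : unitInterval) (σ : G.Profile) (n : G.NonTerminal)
    (m : G.Move n) : (localStrategy (G.explore δ σ) n m).toReal =
      (1 - (δ : ℝ)) * (localStrategy σ n m).toReal +
        δ * (G.uniformStrategy (G.owner n) ⟨n, rfl⟩ m).toReal :=
  mix_apply_toReal _ _ _ _

theorem continuous_expectedPayoff_explore (σ : G.Profile) (i : I) (n : V) :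
    Continuous fun δ : unitInterval => G.expectedPayoff (G.explore δ σ) i n := by
  induction n using G.backward_induction with
  | terminal z => simp_rw [expectedPayoff_terminal]; exact continuous_const
  | nonTerminal n ih =>
    simp_rw [expectedPayoff_nonTerminal, localStrategy_explore_toReal]
    refine continuous_finsetSum _ fun m _ => Continuous.mul ?_ (ih m)
    fun_prop

theorem explore_zero (σ : G.Profile) : G.explore 0 σ = σ := by
  funext i n
  ext m
  rw [← ENNReal.toReal_eq_toReal_iff' (PMF.apply_ne_top _ _) (PMF.apply_ne_top _ _)]
  simp [explore, mix_apply_toReal]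

/-- For small exploration rates the strictly best moves remain strictly best. -/
theorem exists_forall_expectedPayoff_explore_lt {σ : G.Profile}
    {best : (n : G.NonTerminal) → G.Move n}
    (h : ∀ (n : G.NonTerminal) (m : G.Move n), m ≠ best n →
      G.expectedPayoff σ (G.owner n) m.1 < G.expectedPayoff σ (G.owner n) (best n).1) :
    ∃ δ₀ : ℝ, 0 < δ₀ ∧ ∀ δ : unitInterval, (δ : ℝ) < δ₀ →
      ∀ (n : G.NonTerminal) (m : G.Move n), m ≠ best n →
        G.expectedPayoff (G.explore δ σ) (G.owner n) m.1 <
          G.expectedPayoff (G.explore δ σ) (G.owner n) (best n).1 := by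
  have hev : ∀ᶠ δ : unitInterval in nhds 0, ∀ (n : G.NonTerminal) (m : G.Move n), m ≠ best n →
      G.expectedPayoff (G.explore δ σ) (G.owner n) m.1 <
        G.expectedPayoff (G.explore δ σ) (G.owner n) (best n).1 := by
    refine Filter.eventually_all.2 fun n => Filter.eventually_all.2 fun m => ?_
    by_cases hm : m = best n
    · exact Filter.Eventually.of_forall fun _ h => absurd hm h
    · have := ((G.continuous_expectedPayoff_explore σ (G.owner n) m.1).tendsto 0).eventually_lt
        ((G.continuous_expectedPayoff_explore σ (G.owner n) (best n).1).tendsto 0)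
        (by simpa only [explore_zero] using h n m hm)
      exact this.mono fun _ h _ => h
  obtain ⟨ε, hε, H⟩ := Metric.eventually_nhds_iff.1 hev
  refine ⟨ε, hε, fun δ hδ => H ?_⟩
  rw [Subtype.dist_eq, Real.dist_eq]
  simpa [abs_of_nonneg δ.2.1] using hδ

end Outcome

end ExtGame

end

noncomputable section

open Filter Topology in
/-- Kronecker's lemma. -/
theorem tendsto_sum_mul_div_of_tendsto_sum {b y : ℕ → ℝ} {L : ℝ} (hb : Monotone b)
    (hb0 : b 0 = 0) (hbt : Tendsto b atTop atTop)
    (hy : Tendsto (fun t => ∑ s ∈ Finset.range t, y s) atTop (𝓝 L)) :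
    Tendsto (fun t => (∑ s ∈ Finset.range t, b (s + 1) * y s) / b t) atTop (𝓝 0) := by
  set M : ℕ → ℝ := fun t => ∑ s ∈ Finset.range t, y s with hM
  -- Summation by parts, centred at `L`; the remaining sum is a weighted Cesàro mean with weights `b
  -- (s + 1) - b s`.
  have hid : ∀ t, ∑ s ∈ Finset.range t, b (s + 1) * y s =
      b t * (M t - L) - ∑ s ∈ Finset.range t, (b (s + 1) - b s) * (M s - L) := by
    intro t
    induction t with
    | zero => simp [hb0]
    | succ t ih =>
      rw [Finset.sum_range_succ, Finset.sum_range_succ, ih]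
      have : M (t + 1) = M t + y t := Finset.sum_range_succ _ _
      rw [this]
      ring
  have ho : (fun t => M t - L) =o[atTop] fun _ => (1 : ℝ) := by
    rw [Asymptotics.isLittleO_one_iff]
    simpa using hy.sub_const L
  have hsum : (fun t => ∑ s ∈ Finset.range t, (b (s + 1) - b s)) = b := by
    funext t
    rw [Finset.sum_range_sub, hb0, sub_zero]
  have h1 : (fun t => b t * (M t - L)) =o[atTop] b := by
    simpa using (Asymptotics.isBigO_refl b atTop).mul_isLittleO ho
  have h2 : (fun t => ∑ s ∈ Finset.range t, (b (s + 1) - b s) * (M s - L)) =o[atTop] b := by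
    have h := Asymptotics.IsLittleO.sum_range
      (f := fun s => (b (s + 1) - b s) * (M s - L)) (g := fun s => b (s + 1) - b s)
      (by simpa using (Asymptotics.isBigO_refl (fun s => b (s + 1) - b s) atTop).mul_isLittleO ho)
      (fun s => sub_nonneg.2 (hb s.le_succ)) (by rwa [hsum])
    rwa [hsum] at h
  simpa only [hid] using (h1.sub h2).tendsto_div_nhds_zero

namespace ExtGame

open scoped Classical

variable {I V : Type*} {G : ExtGame I V}

/-! ### Finite histories -/

theorem firstRounds_zero (ω : ℕ → G.Terminal) : firstRounds ω 0 = [] := by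
  simp [firstRounds]

theorem firstRounds_succ (ω : ℕ → G.Terminal) (t : ℕ) :
    firstRounds ω (t + 1) = firstRounds ω t ++ [ω t] := by
  rw [firstRounds, List.ofFn_succ_last]
  rfl

theorem length_firstRounds (ω : ℕ → G.Terminal) (t : ℕ) : (firstRounds ω t).length = t := by
  simp [firstRounds]

theorem take_firstRounds (ω : ℕ → G.Terminal) {s t : ℕ} (h : s ≤ t) :
    (firstRounds ω t).take s = firstRounds ω s := by
  induction t, h using Nat.le_induction with
  | base => rw [List.take_of_length_le (length_firstRounds ω s).le]
  | succ t hst ih =>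
    rw [firstRounds_succ, List.take_append_of_le_length (by rwa [length_firstRounds]), ih]

/-- The sum of `e h z` over all prefixes `h ++ [z]` of a list. -/
def prefixSum {α : Type*} (e : List α → α → ℝ) (h : List α) : ℝ :=
  (h.foldl (fun p z => (p.1 ++ [z], p.2 + e p.1 z)) (([] : List α), (0 : ℝ))).2

theorem prefixSum_nil {α : Type*} (e : List α → α → ℝ) : prefixSum e [] = 0 := rfl

theorem prefixSum_append_singleton {α : Type*} (e : List α → α → ℝ) (h : List α) (z : α) :
    prefixSum e (h ++ [z]) = prefixSum e h + e h z := by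
  have key : ∀ h : List α,
      (h.foldl (fun p z => (p.1 ++ [z], p.2 + e p.1 z)) (([] : List α), (0 : ℝ))).1 = h := by
    intro h
    induction h using List.reverseRecOn with
    | nil => rfl
    | append_singleton h z ih => simp [List.foldl_append, ih]
  simp [prefixSum, List.foldl_append, key]

theorem prefixSum_firstRounds (e : List G.Terminal → G.Terminal → ℝ) (ω : ℕ → G.Terminal)
    (t : ℕ) :
    prefixSum e (firstRounds ω t) = ∑ s ∈ Finset.range t, e (firstRounds ω s) (ω s) := by
  induction t with
  | zero => simp [firstRounds_zero, prefixSum_nil]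
  | succ t ih => rw [firstRounds_succ, prefixSum_append_singleton, ih, Finset.sum_range_succ]

/-- The number of rounds of `h` whose outcome satisfies `W`. -/
def visitCount (W : G.Terminal → Prop) (h : List G.Terminal) : ℕ := h.countP fun z => W z

theorem visitCount_nil (W : G.Terminal → Prop) : visitCount W [] = 0 := rfl

theorem visitCount_append_singleton (W : G.Terminal → Prop) (h : List G.Terminal)
    (z : G.Terminal) : visitCount W (h ++ [z]) = visitCount W h + if W z then 1 else 0 := by
  simp [visitCount, List.countP_append, List.countP_singleton]

theorem monotone_visitCount (W : G.Terminal → Prop) (ω : ℕ → G.Terminal) :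
    Monotone fun t => visitCount W (firstRounds ω t) :=
  monotone_nat_of_le_succ fun t => by
    rw [firstRounds_succ, visitCount_append_singleton]; omega

theorem sum_visit_firstRounds (W : G.Terminal → Prop) (ω : ℕ → G.Terminal) (t : ℕ) :
    ∑ s ∈ Finset.range t, (if W (ω s) then (1 : ℝ) else 0) = visitCount W (firstRounds ω t) := by
  induction t with
  | zero => simp [firstRounds_zero, visitCount_nil]
  | succ t ih =>
    rw [Finset.sum_range_succ, ih, firstRounds_succ, visitCount_append_singleton]
    push_cast
    rfl

/-- The increments of `d` divided by the running number of visits to `W`. -/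
def scaled (W : G.Terminal → Prop) (d : List G.Terminal → G.Terminal → ℝ)
    (h : List G.Terminal) (z : G.Terminal) : ℝ := ((visitCount W h : ℝ) + 1)⁻¹ * d h z

/-- At a visit with `N` earlier ones, `1/(N+1)² ≤ 2/(N+1) - 2/(N+2)`, so the squared increments are
paid for by a telescoping potential; without a visit nothing changes. -/
theorem sq_scaled_le {W : G.Terminal → Prop} {d : List G.Terminal → G.Terminal → ℝ} {C : ℝ}
    (hC : ∀ h z, |d h z| ≤ C) (hW : ∀ h z, ¬ W z → d h z = 0) (h : List G.Terminal)
    (z : G.Terminal) :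
    scaled W d h z ^ 2 + 2 * C ^ 2 * ((visitCount W (h ++ [z]) : ℝ) + 1)⁻¹ ≤
      2 * C ^ 2 * ((visitCount W h : ℝ) + 1)⁻¹ := by
  rw [visitCount_append_singleton]
  by_cases hz : W z
  · have hN : (0 : ℝ) ≤ visitCount W h := Nat.cast_nonneg _
    set N : ℝ := (visitCount W h : ℝ) with hNdef
    have hd : d h z ^ 2 ≤ C ^ 2 := sq_le_sq' (abs_le.1 (hC h z)).1 (abs_le.1 (hC h z)).2
    have h1 : ((N + 1)⁻¹) ^ 2 ≤ 2 * (N + 1)⁻¹ - 2 * (N + 1 + 1)⁻¹ := by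
      have : 2 * (N + 1)⁻¹ - 2 * (N + 1 + 1)⁻¹ - ((N + 1)⁻¹) ^ 2 =
          N / ((N + 1) ^ 2 * (N + 1 + 1)) := by
        field_simp
        ring
      have h2 : 0 ≤ N / ((N + 1) ^ 2 * (N + 1 + 1)) := by positivity
      linarith
    have h3 : scaled W d h z ^ 2 ≤ (2 * (N + 1)⁻¹ - 2 * (N + 1 + 1)⁻¹) * C ^ 2 := by
      rw [scaled, mul_pow]
      exact mul_le_mul h1 hd (sq_nonneg _) ((sq_nonneg _).trans h1)
    simp only [hz, if_true]
    push_cast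
    nlinarith
  · simp [scaled, hW h z hz, hz]

/-! ### The law of a round given the history, and the resulting martingales -/

section Play

variable [Fintype V]

theorem measurable_firstRounds (t : ℕ) :
    @Measurable _ (List G.Terminal) _ ⊤ fun ω : ℕ → G.Terminal => firstRounds ω t := by
  let _ : MeasurableSpace (List G.Terminal) := ⊤
  exact (measurable_of_finite (List.ofFn : (Fin t → G.Terminal) → List G.Terminal)).comp
    (measurable_pi_lambda (fun (ω : ℕ → G.Terminal) (k : Fin t) => ω k)
      fun k => measurable_pi_apply _)

variable (G) in
/-- The filtration generated by the finite histories. -/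
def historyFiltration : Filtration ℕ (inferInstance : MeasurableSpace (ℕ → G.Terminal)) where
  seq t := MeasurableSpace.comap (fun ω => firstRounds ω t) ⊤
  mono' s t hst := by
    rintro _ ⟨A, -, rfl⟩
    refine ⟨{h | h.take s ∈ A}, trivial, ?_⟩
    ext ω
    simp [take_firstRounds ω hst]
  le' t := by
    rintro _ ⟨A, -, rfl⟩
    exact @measurable_firstRounds _ _ G _ t A trivial

/-- There are finitely many histories of length `t`, so any function of them is bounded. -/
theorem integrable_firstRounds (μ : Measure (ℕ → G.Terminal)) [IsFiniteMeasure μ] (t : ℕ)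
    (φ : List G.Terminal → ℝ) : Integrable (fun ω => φ (firstRounds ω t)) μ := by
  obtain ⟨C, hC⟩ := (Set.finite_range fun x : Fin t → G.Terminal => |φ (List.ofFn x)|).bddAbove
  refine Integrable.of_bound (C := C) ?_ (Filter.Eventually.of_forall fun ω => ?_)
  · let _ : MeasurableSpace (List G.Terminal) := ⊤
    exact ((measurable_from_top (f := φ)).comp
      (measurable_firstRounds t)).aestronglyMeasurable
  · exact hC ⟨fun k : Fin t => ω k, rfl⟩

variable (S : (i : I) → G.SuperStrategy i)

instance : IsProbabilityMeasure (G.superPlay S) := by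
  unfold superPlay; infer_instance

/-- The conditional expectation of `g z`, where `z` is the outcome of the round that follows the
history `h`. -/
def nextMean (h : List G.Terminal) (g : G.Terminal → ℝ) : ℝ :=
  ∑ z, G.outcomeProb (fun i => S i h) G.root z * g z

theorem integral_roundLaw (h : List G.Terminal) (g : G.Terminal → ℝ) :
    ∫ z, g z ∂(G.roundLaw S h) = nextMean S h g := by
  rw [roundLaw, PMF.integral_eq_sum]
  rfl

theorem map_eval_zero_superPlay :
    (G.superPlay S).map (fun ω => ω 0) = G.roundLaw S [] := by
  have h1 : (fun ω : ℕ → G.Terminal => ω 0) =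
      (fun x : (i : Finset.Iic 0) → G.Terminal => x ⟨0, by simp⟩) ∘
        Preorder.frestrictLe (π := fun _ => G.Terminal) 0 := rfl
  rw [h1, ← Measure.map_map (by fun_prop) (by fun_prop), superPlay, Kernel.trajMeasure,
    Measure.map_comp _ _ (by fun_prop), Kernel.traj_map_frestrictLe, Kernel.partialTraj_self,
    Measure.id_comp, Measure.map_map (by fun_prop) (by fun_prop)]
  exact Measure.map_id

/-- The law of a round given the preceding history. -/
theorem integral_superPlay (t : ℕ) (g : List G.Terminal → G.Terminal → ℝ) :
    ∫ ω, g (firstRounds ω t) (ω t) ∂(G.superPlay S) =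
      ∫ ω, nextMean S (firstRounds ω t) (g (firstRounds ω t)) ∂(G.superPlay S) := by
  cases t with
  | zero =>
    simp_rw [firstRounds_zero]
    rw [integral_const, ← integral_roundLaw, ← map_eval_zero_superPlay,
      integral_map (measurable_pi_apply 0).aemeasurable
        (Measurable.aestronglyMeasurable measurable_from_top)]
    simp
  | succ t =>
    -- The list is read off the first `t + 1` coordinates exactly as in `roundKernel`, so the joint
    -- law of history and next outcome is a composition product.
    let L : ((_ : Finset.Iic t) → G.Terminal) → List G.Terminal := fun x =>
      List.ofFn fun k : Fin (t + 1) => x ⟨k.1, Finset.mem_Iic.2 (Nat.lt_succ_iff.1 k.2)⟩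
    have hf : Measurable fun p : ((_ : Finset.Iic t) → G.Terminal) × G.Terminal =>
        g (L p.1) p.2 := measurable_of_finite _
    have h1 : ∫ ω, g (firstRounds ω (t + 1)) (ω (t + 1)) ∂(G.superPlay S) =
        ∫ p, g (L p.1) p.2 ∂((G.superPlay S).map fun ω =>
          (Preorder.frestrictLe (π := fun _ => G.Terminal) t ω, ω (t + 1))) := by
      rw [integral_map (by fun_prop) hf.aestronglyMeasurable]
      rfl
    have h2 : (G.superPlay S).map (fun ω =>
          (Preorder.frestrictLe (π := fun _ => G.Terminal) t ω, ω (t + 1))) =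
        ((G.superPlay S).map (Preorder.frestrictLe (π := fun _ => G.Terminal) t)).compProd
          (G.roundKernel S t) :=
      (Kernel.map_frestrictLe_trajMeasure_compProd_eq_map_trajMeasure
        (X := fun _ => G.Terminal)).symm
    have : IsProbabilityMeasure
        ((G.superPlay S).map (Preorder.frestrictLe (π := fun _ => G.Terminal) t)) :=
      Measure.isProbabilityMeasure_map (by fun_prop)
    rw [h1, h2, Measure.integral_compProd (Integrable.of_finite),
      integral_map (by fun_prop) (Measurable.aestronglyMeasurable (measurable_of_finite _))]
    refine integral_congr_ae (Filter.Eventually.of_forall fun ω => ?_)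
    exact integral_roundLaw S _ _

theorem nextMean_add (h : List G.Terminal) (f g : G.Terminal → ℝ) :
    nextMean S h (fun z => f z + g z) = nextMean S h f + nextMean S h g := by
  simp [nextMean, mul_add, Finset.sum_add_distrib]

theorem nextMean_const_mul (h : List G.Terminal) (c : ℝ) (g : G.Terminal → ℝ) :
    nextMean S h (fun z => c * g z) = c * nextMean S h g := by
  simp only [nextMean, Finset.mul_sum]
  exact Finset.sum_congr rfl fun z _ => by ring

theorem nextMean_const (h : List G.Terminal) (c : ℝ) : nextMean S h (fun _ => c) = c := by
  rw [nextMean, ← Finset.sum_mul, sum_outcomeProb, one_mul]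

theorem nextMean_mono (h : List G.Terminal) {f g : G.Terminal → ℝ} (hfg : ∀ z, f z ≤ g z) :
    nextMean S h f ≤ nextMean S h g :=
  Finset.sum_le_sum fun z _ => mul_le_mul_of_nonneg_left (hfg z) (G.outcomeProb_nonneg _ _ _)

theorem abs_nextMean_le (h : List G.Terminal) {g : G.Terminal → ℝ} {C : ℝ}
    (hg : ∀ z, |g z| ≤ C) : |nextMean S h g| ≤ C := by
  refine abs_le.2 ⟨?_, ?_⟩
  · rw [← nextMean_const S h (-C)]
    exact nextMean_mono S h fun z => (abs_le.1 (hg z)).1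
  · conv_rhs => rw [← nextMean_const S h C]
    exact nextMean_mono S h fun z => (abs_le.1 (hg z)).2

theorem martingale_prefixSum {e : List G.Terminal → G.Terminal → ℝ}
    (he : ∀ h, nextMean S h (e h) = 0) :
    Martingale (fun t ω => prefixSum e (firstRounds ω t)) G.historyFiltration
      (G.superPlay S) := by
  refine martingale_of_setIntegral_eq_succ (fun t => ?_)
    (fun t => integrable_firstRounds _ t _) fun t s hs => ?_
  · refine Measurable.stronglyMeasurable ?_
    let _ : MeasurableSpace (List G.Terminal) := ⊤
    exact (measurable_from_top (f := prefixSum e)).comp (comap_measurable _)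
  · obtain ⟨A, -, rfl⟩ := hs
    have hA : MeasurableSet ((fun ω : ℕ → G.Terminal => firstRounds ω t) ⁻¹' A) :=
      @measurable_firstRounds _ _ G _ t A trivial
    rw [← integral_indicator hA, ← integral_indicator hA]
    have h1 : ∀ ω : ℕ → G.Terminal, ((fun ω => firstRounds ω t) ⁻¹' A).indicator
        (fun ω => prefixSum e (firstRounds ω (t + 1))) ω =
        (fun h z => A.indicator (fun _ => (1 : ℝ)) h * (prefixSum e h + e h z))
          (firstRounds ω t) (ω t) := by
      intro ω
      by_cases h : firstRounds ω t ∈ A <;>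
        simp [Set.indicator, h, firstRounds_succ, prefixSum_append_singleton]
    simp_rw [h1]
    rw [integral_superPlay S t fun h z => A.indicator (fun _ => (1 : ℝ)) h * (prefixSum e h + e h z)]
    refine integral_congr_ae (Filter.Eventually.of_forall fun ω => ?_)
    simp only [nextMean_const_mul, nextMean_add, nextMean_const, he, add_zero]
    by_cases h : firstRounds ω t ∈ A <;> simp [Set.indicator, h]

theorem integral_firstRounds_le {F : List G.Terminal → ℝ}
    (hF : ∀ h, nextMean S h (fun z => F (h ++ [z])) ≤ F h) (t : ℕ) :
    ∫ ω, F (firstRounds ω t) ∂(G.superPlay S) ≤ F [] := by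
  induction t with
  | zero => simp [firstRounds_zero]
  | succ t ih =>
    refine le_trans ?_ ih
    simp_rw [firstRounds_succ]
    rw [integral_superPlay S t fun h z => F (h ++ [z])]
    exact integral_mono
      (integrable_firstRounds _ t fun h => nextMean S h fun z => F (h ++ [z]))
      (integrable_firstRounds _ t F) fun ω => hF _

/-! ### Laws of large numbers along visits -/

theorem integral_sq_prefixSum_scaled_le {W : G.Terminal → Prop}
    {d : List G.Terminal → G.Terminal → ℝ} {C : ℝ} (hC : ∀ h z, |d h z| ≤ C)
    (hW : ∀ h z, ¬ W z → d h z = 0) (hd : ∀ h, nextMean S h (d h) = 0) (t : ℕ) :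
    ∫ ω, prefixSum (scaled W d) (firstRounds ω t) ^ 2 ∂(G.superPlay S) ≤ 2 * C ^ 2 := by
  -- A supermartingale: the cross term of the square has conditional mean zero, and the potential
  -- from `sq_scaled_le` absorbs the squared increment. Its initial value is `2 * C ^ 2`.
  let F : List G.Terminal → ℝ := fun h =>
    prefixSum (scaled W d) h ^ 2 + 2 * C ^ 2 * ((visitCount W h : ℝ) + 1)⁻¹
  have hF : ∀ h, nextMean S h (fun z => F (h ++ [z])) ≤ F h := by
    intro h
    have hmean : nextMean S h (scaled W d h) = 0 := by
      change nextMean S h (fun z => ((visitCount W h : ℝ) + 1)⁻¹ * d h z) = 0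
      rw [nextMean_const_mul, hd, mul_zero]
    calc nextMean S h (fun z => F (h ++ [z]))
        ≤ nextMean S h (fun z => F h + 2 * prefixSum (scaled W d) h * scaled W d h z) := by
          refine nextMean_mono S h fun z => ?_
          have := sq_scaled_le hC hW h z
          simp only [F, prefixSum_append_singleton]
          nlinarith
      _ = F h := by rw [nextMean_add, nextMean_const, nextMean_const_mul, hmean]; ring
  refine le_trans (integral_mono (integrable_firstRounds _ t fun h => _ ^ 2)
    (integrable_firstRounds _ t F) fun ω => ?_)
    ((integral_firstRounds_le S hF t).trans_eq ?_)
  · have : 0 ≤ 2 * C ^ 2 * ((visitCount W (firstRounds ω t) : ℝ) + 1)⁻¹ := by positivity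
    simpa only [F] using le_add_of_nonneg_right this
  · simp [F, prefixSum_nil, visitCount_nil]

/-- The scaling factor depends only on the past, so the martingale property persists; the L² bound
gives an L¹ bound through `|x| ≤ 1 + x²`, and Doob's convergence theorem applies. -/
theorem ae_exists_tendsto_prefixSum_scaled {W : G.Terminal → Prop}
    {d : List G.Terminal → G.Terminal → ℝ} {C : ℝ} (hC : ∀ h z, |d h z| ≤ C)
    (hW : ∀ h z, ¬ W z → d h z = 0) (hd : ∀ h, nextMean S h (d h) = 0) :
    ∀ᵐ ω ∂(G.superPlay S), ∃ c, Filter.Tendsto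
      (fun t => prefixSum (scaled W d) (firstRounds ω t)) Filter.atTop (nhds c) := by
  have hM := martingale_prefixSum S (e := scaled W d) fun h => by
    change nextMean S h (fun z => ((visitCount W h : ℝ) + 1)⁻¹ * d h z) = 0
    rw [nextMean_const_mul, hd, mul_zero]
  refine hM.submartingale.exists_ae_tendsto_of_bdd (R := (1 + 2 * C ^ 2).toNNReal) fun t => ?_
  rw [eLpNorm_one_eq_lintegral_enorm,
    ← ofReal_integral_norm_eq_lintegral_enorm (integrable_firstRounds _ t _)]
  refine ENNReal.ofReal_le_ofReal ?_
  calc ∫ ω, ‖prefixSum (scaled W d) (firstRounds ω t)‖ ∂(G.superPlay S)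
      ≤ ∫ ω, (1 + prefixSum (scaled W d) (firstRounds ω t) ^ 2) ∂(G.superPlay S) := by
        refine integral_mono (integrable_firstRounds _ t fun h => ‖_‖)
          (integrable_firstRounds _ t fun h => 1 + _ ^ 2) fun ω => ?_
        dsimp only
        rw [Real.norm_eq_abs, abs_le]
        constructor <;> nlinarith [sq_nonneg (prefixSum (scaled W d) (firstRounds ω t) - 1),
          sq_nonneg (prefixSum (scaled W d) (firstRounds ω t) + 1)]
    _ ≤ 1 + 2 * C ^ 2 := by
        rw [integral_add (integrable_const _) (integrable_firstRounds _ t fun h => _ ^ 2)]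
        simpa using integral_sq_prefixSum_scaled_le S hC hW hd t

open Filter Topology in
/-- The strong law of large numbers for bounded increments with conditional mean zero, averaged
over the rounds whose outcome satisfies `W`. -/
theorem ae_tendsto_average {W : G.Terminal → Prop}
    {d : List G.Terminal → G.Terminal → ℝ} {C : ℝ} (hC : ∀ h z, |d h z| ≤ C)
    (hW : ∀ h z, ¬ W z → d h z = 0) (hd : ∀ h, nextMean S h (d h) = 0) :
    ∀ᵐ ω ∂(G.superPlay S),
      Tendsto (fun t => (visitCount W (firstRounds ω t) : ℝ)) atTop atTop →
      Tendsto (fun t => (∑ s ∈ Finset.range t, d (firstRounds ω s) (ω s)) /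
        (visitCount W (firstRounds ω t) : ℝ)) atTop (𝓝 0) := by
  filter_upwards [ae_exists_tendsto_prefixSum_scaled S hC hW hd] with ω ⟨c, hc⟩ hN
  simp_rw [prefixSum_firstRounds] at hc
  have key := tendsto_sum_mul_div_of_tendsto_sum
    (b := fun t => (visitCount W (firstRounds ω t) : ℝ))
    (fun s t hst => Nat.cast_le.2 (monotone_visitCount W ω hst))
    (by simp [firstRounds_zero, visitCount_nil]) hN hc
  refine key.congr fun t => ?_
  congr 1
  refine Finset.sum_congr rfl fun s _ => ?_
  -- At a visit the count after the round is the count before it plus one, which cancels the scaling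
  -- exactly; elsewhere `d` vanishes.
  rw [firstRounds_succ, visitCount_append_singleton, scaled]
  by_cases hz : W (ω s)
  · rw [if_pos hz]
    push_cast
    rw [mul_inv_cancel_left₀ (by positivity)]
  · rw [hW _ _ hz, mul_zero, mul_zero]

open Filter Topology in
/-- An event whose conditional probability is bounded below occurs infinitely often. -/
theorem ae_tendsto_visitCount {W : G.Terminal → Prop} {c : ℝ} (hc : 0 < c)
    (hW : ∀ h, c ≤ nextMean S h fun z => if W z then 1 else 0) :
    ∀ᵐ ω ∂(G.superPlay S),
      Tendsto (fun t => (visitCount W (firstRounds ω t) : ℝ)) atTop atTop := by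
  set p : List G.Terminal → ℝ := fun h => nextMean S h fun z => if W z then 1 else 0
  have hp : ∀ h, |p h| ≤ 1 := fun h => abs_nextMean_le S h fun z => by split_ifs <;> simp
  -- With every round counted as a visit, the visit frequency of `W` is asymptotically the mean of
  -- the conditional probabilities, hence eventually above `c / 2`.
  have hmain := ae_tendsto_average S (W := fun _ => True)
    (d := fun h z => (if W z then 1 else 0) + -p h) (C := 2) (fun h z => by
      refine (abs_add_le _ _).trans ?_
      have : |(if W z then (1 : ℝ) else 0)| ≤ 1 := by split_ifs <;> simp
      rw [abs_neg]
      linarith [hp h])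
    (fun h z hz => absurd trivial hz)
    (fun h => by rw [nextMean_add, nextMean_const]; exact add_neg_cancel _)
  filter_upwards [hmain] with ω hω
  have hlen : ∀ t, (visitCount (fun _ => True) (firstRounds ω t) : ℝ) = t := by
    intro t
    simp [visitCount, length_firstRounds]
  simp_rw [hlen] at hω
  specialize hω tendsto_natCast_atTop_atTop
  have hev := hω.eventually (lt_mem_nhds (show -(c / 2) < 0 by linarith))
  have hlin : Tendsto (fun t : ℕ => c / 2 * (t : ℝ)) atTop atTop :=
    tendsto_natCast_atTop_atTop.const_mul_atTop (by linarith)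
  refine tendsto_atTop_mono' _ ?_ hlin
  filter_upwards [hev, eventually_gt_atTop 0] with t ht ht0
  have ht0' : (0 : ℝ) < t := Nat.cast_pos.2 ht0
  rw [lt_div_iff₀ ht0', Finset.sum_add_distrib, sum_visit_firstRounds, Finset.sum_neg_distrib]
    at ht
  have hsum : (t : ℝ) * c ≤ ∑ s ∈ Finset.range t, p (firstRounds ω s) := by
    simpa using Finset.card_nsmul_le_sum (Finset.range t) (fun s => p (firstRounds ω s)) c
      fun s _ => hW _
  linarith

end Play

/-! ### Convergence of the averaging valuation -/

theorem sum_map_filter_firstRounds (W : G.Terminal → Prop) (f : G.Terminal → ℝ)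
    (ω : ℕ → G.Terminal) (t : ℕ) :
    (((firstRounds ω t).filter fun z => W z).map f).sum =
      ∑ s ∈ Finset.range t, if W (ω s) then f (ω s) else 0 := by
  induction t with
  | zero => simp [firstRounds_zero]
  | succ t ih =>
    rw [Finset.sum_range_succ, firstRounds_succ, List.filter_append, List.map_append,
      List.sum_append, ih]
    by_cases h : W (ω t) <;> simp [h]

theorem averaging_firstRounds {i : I} (v : G.Valuation i) (ω : ℕ → G.Terminal) (m : G.MoveOf i)
    {t : ℕ} (ht : visitCount (fun z : G.Terminal => G.OnPath m.1 z.1) (firstRounds ω t) ≠ 0) :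
    G.averaging v (firstRounds ω t) m =
      (∑ s ∈ Finset.range t, if G.OnPath m.1 (ω s).1 then G.payoff i (ω s) else 0) /
        (visitCount (fun z : G.Terminal => G.OnPath m.1 z.1) (firstRounds ω t) : ℝ) := by
  rw [visitCount, List.countP_eq_length_filter] at ht ⊢
  rw [averaging]
  rw [if_neg fun h => ht (by rw [h]; rfl),
    sum_map_filter_firstRounds (fun z : G.Terminal => G.OnPath m.1 z.1)]

theorem myopic_eq_pure [Fintype V] {i : I} {v : G.Valuation i} {n : G.NodeOf i}
    {b : G.Move n.1} (h : ∀ m, m ≠ b → v.at n m < v.at n b) : G.myopic v n = PMF.pure b := by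
  have hset : (Finset.univ.filter fun m : G.Move n.1 =>
      ∀ m' : G.Move n.1, v.at n m' ≤ v.at n m) = {b} := by
    ext m
    simp only [Finset.mem_filter, Finset.mem_univ, true_and, Finset.mem_singleton]
    constructor
    · intro hm
      by_contra hne
      exact absurd (hm b) (not_le.2 (h m hne))
    · rintro rfl m'
      by_cases hm' : m' = m
      · rw [hm']
      · exact (h m' hm').le
  ext m
  rw [myopic, PMF.uniformOfFinset_apply, hset]
  simp [PMF.pure_apply]

open Filter Topology in
/-- If the continuation payoff of `m` is eventually constant along a history, and the payoffs
in the rounds reaching `m` obey the law of large numbers, then the valuation of `m` converges. -/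
theorem tendsto_averaging {i : I} (v : G.Valuation i) (ω : ℕ → G.Terminal) (m : G.MoveOf i)
    {c : ℕ → ℝ} {L : ℝ}
    (hN : Tendsto (fun t => (visitCount (fun z : G.Terminal => G.OnPath m.1 z.1)
      (firstRounds ω t) : ℝ)) atTop atTop)
    (hd : Tendsto (fun t => (∑ s ∈ Finset.range t,
      if G.OnPath m.1 (ω s).1 then G.payoff i (ω s) - c s else 0) /
        (visitCount (fun z : G.Terminal => G.OnPath m.1 z.1) (firstRounds ω t) : ℝ))
      atTop (𝓝 0))
    (hc : ∀ᶠ t in atTop, c t = L) :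
    Tendsto (fun t => G.averaging v (firstRounds ω t) m) atTop (𝓝 L) := by
  set W : G.Terminal → Prop := fun z => G.OnPath m.1 z.1
  have h1 : (fun s => if W (ω s) then c s - L else 0) =o[atTop]
      fun s => if W (ω s) then (1 : ℝ) else 0 := by
    have : (fun s => if W (ω s) then c s - L else 0) =ᶠ[atTop] fun _ => (0 : ℝ) := by
      filter_upwards [hc] with s hs
      simp [hs]
    exact this.trans_isLittleO (Asymptotics.isLittleO_zero _ _)
  -- Cesàro averaging weighted by the visit indicators, whose partial sums are the diverging visit
  -- counts.
  have h2 := h1.sum_range (fun s => by dsimp only; split_ifs <;> simp)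
    (by simpa only [sum_visit_firstRounds] using hN)
  simp only [sum_visit_firstRounds] at h2
  have h3 := (hd.add h2.tendsto_div_nhds_zero).add_const L
  rw [add_zero, zero_add] at h3
  refine h3.congr' ?_
  filter_upwards [hN.eventually_gt_atTop 0] with t ht
  rw [averaging_firstRounds v ω m (Nat.cast_ne_zero.1 ht.ne'), ← add_div, div_add' _ _ _ ht.ne',
    ← sum_visit_firstRounds, Finset.mul_sum, ← Finset.sum_add_distrib, ← Finset.sum_add_distrib]
  congr 1
  refine Finset.sum_congr rfl fun s _ => ?_
  by_cases h : W (ω s)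
  · have h' : G.OnPath m.1 (ω s).1 := h
    simp [h, h']
  · have h' : ¬ G.OnPath m.1 (ω s).1 := h
    simp [h, h']

/-! ### Play by valuation: recurrence of all nodes and settling of play -/

section Play

variable [Fintype V]

theorem localStrategy_valuation (v : (i : I) → G.Valuation i) (δ : unitInterval)
    (h : List G.Terminal) (n : G.NonTerminal) :
    localStrategy (fun i => G.valuationSuperStrategy δ (v i) h) n =
      mix δ (G.myopic (G.averaging (v (G.owner n)) h) ⟨n, rfl⟩)
        (G.uniformStrategy (G.owner n) ⟨n, rfl⟩) := rfl

theorem le_localStrategy_valuation (v : (i : I) → G.Valuation i) (δ : unitInterval)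
    (h : List G.Terminal) (n : G.NonTerminal) (m : G.Move n) :
    (δ : ℝ) * (Fintype.card V : ℝ)⁻¹ ≤
      (localStrategy (fun i => G.valuationSuperStrategy δ (v i) h) n m).toReal := by
  rw [localStrategy_valuation, mix_apply_toReal]
  have h1 : 0 ≤ (1 - (δ : ℝ)) *
      (G.myopic (G.averaging (v (G.owner n)) h) ⟨n, rfl⟩ m).toReal :=
    mul_nonneg (by linarith [δ.2.2]) ENNReal.toReal_nonneg
  have h2 : (Fintype.card V : ℝ)⁻¹ ≤ (G.uniformStrategy (G.owner n) ⟨n, rfl⟩ m).toReal := by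
    rw [uniformStrategy, PMF.uniformOfFintype_apply, ENNReal.toReal_inv, ENNReal.toReal_natCast]
    have hpos : 0 < Fintype.card (G.Move n) := Fintype.card_pos
    gcongr
    exact Fintype.card_subtype_le _
  exact (mul_le_mul_of_nonneg_left h2 δ.2.1).trans (le_add_of_nonneg_left h1)

/-- With exploration every node is almost surely reached infinitely often. -/
theorem ae_tendsto_visitCount_onPath (v : (i : I) → G.Valuation i) {δ : unitInterval}
    (hδ : 0 < (δ : ℝ)) (m : V) :
    ∀ᵐ ω ∂(G.superPlay fun i => G.valuationSuperStrategy δ (v i)),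
      Filter.Tendsto (fun t => (visitCount (fun z : G.Terminal => G.OnPath m z.1)
        (firstRounds ω t) : ℝ)) Filter.atTop Filter.atTop := by
  obtain ⟨k, hk⟩ := G.exists_pow_le_sum_outcomeProb m
  have : Nonempty V := ⟨m⟩
  have hε : 0 < (δ : ℝ) * (Fintype.card V : ℝ)⁻¹ := by
    have : 0 < Fintype.card V := Fintype.card_pos
    positivity
  exact ae_tendsto_visitCount _ (pow_pos hε k) fun h =>
    hk _ _ hε.le (le_localStrategy_valuation v δ h)

/-- The payoffs in the rounds reaching `m` obey the law of large numbers. -/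
theorem ae_tendsto_average_payoff (S : (i : I) → G.SuperStrategy i) (i : I) (m : V) :
    ∀ᵐ ω ∂(G.superPlay S),
      Filter.Tendsto (fun t => (visitCount (fun z : G.Terminal => G.OnPath m z.1)
        (firstRounds ω t) : ℝ)) Filter.atTop Filter.atTop →
      Filter.Tendsto (fun t => (∑ s ∈ Finset.range t, if G.OnPath m (ω s).1 then
          G.payoff i (ω s) - G.expectedPayoff (fun i => S i (firstRounds ω s)) i m else 0) /
        (visitCount (fun z : G.Terminal => G.OnPath m z.1) (firstRounds ω t) : ℝ))
        Filter.atTop (nhds 0) := by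
  refine ae_tendsto_average S (W := fun z : G.Terminal => G.OnPath m z.1)
    (d := fun h z => if G.OnPath m z.1 then
      G.payoff i z - G.expectedPayoff (fun i => S i h) i m else 0)
    (C := (∑ z, |G.payoff i z|) + ∑ z, |G.payoff i z|) (fun h z => ?_)
    (fun h z hz => if_neg hz) (fun h => G.sum_outcomeProb_mul_sub_expectedPayoff _ i m)
  have h0 : 0 ≤ ∑ z, |G.payoff i z| := Finset.sum_nonneg fun _ _ => abs_nonneg _
  split_ifs
  · refine (abs_sub _ _).trans (add_le_add ?_ (G.abs_expectedPayoff_le _ i m))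
    exact Finset.single_le_sum (f := fun z => |G.payoff i z|) (fun _ _ => abs_nonneg _)
      (Finset.mem_univ z)
  · rw [abs_zero]
    exact add_nonneg h0 h0

open Filter Topology in
/-- Along a history that reaches every node infinitely often and obeys the laws of large
numbers, play settles at every node, by induction from the terminal nodes to the root. -/
theorem eventually_localStrategy_eq {β : G.Profile} {best : (n : G.NonTerminal) → G.Move n}
    (hβ : ∀ n, localStrategy β n = PMF.pure (best n)) {δ : unitInterval}
    (hbest : ∀ (n : G.NonTerminal) (m : G.Move n), m ≠ best n →
      G.expectedPayoff (G.explore δ β) (G.owner n) m.1 <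
        G.expectedPayoff (G.explore δ β) (G.owner n) (best n).1)
    (v : (i : I) → G.Valuation i) (ω : ℕ → G.Terminal)
    (hN : ∀ m : V, Tendsto (fun t => (visitCount (fun z : G.Terminal => G.OnPath m z.1)
      (firstRounds ω t) : ℝ)) atTop atTop)
    (hd : ∀ (i : I) (m : V), Tendsto (fun t => (∑ s ∈ Finset.range t,
      if G.OnPath m (ω s).1 then G.payoff i (ω s) - G.expectedPayoff
        (fun i => G.valuationSuperStrategy δ (v i) (firstRounds ω s)) i m else 0) /
        (visitCount (fun z : G.Terminal => G.OnPath m z.1) (firstRounds ω t) : ℝ))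
      atTop (𝓝 0)) (n : V) :
    ∀ k : G.NonTerminal, G.OnPath n k.1 → ∀ᶠ t in atTop,
      localStrategy (fun i => G.valuationSuperStrategy δ (v i) (firstRounds ω t)) k =
        localStrategy (G.explore δ β) k := by
  induction n using G.backward_induction with
  | terminal z =>
    intro k hk
    rcases Relation.ReflTransGen.cases_head hk with h | ⟨m, hm, -⟩
    · exact absurd (h ▸ k.2) z.2
    · exact absurd ⟨m, hm⟩ z.2
  | nonTerminal n ih =>
    intro k hk
    rcases Relation.ReflTransGen.cases_head hk with h | ⟨m, hm, hmk⟩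
    swap
    · exact ih ⟨m, hm⟩ k hmk
    obtain rfl : n = k := Subtype.ext h
    have hlim : ∀ m : G.Move n, Tendsto
        (fun t => (G.averaging (v (G.owner n)) (firstRounds ω t)).at ⟨n, rfl⟩ m) atTop
        (𝓝 (G.expectedPayoff (G.explore δ β) (G.owner n) m.1)) := by
      intro m
      refine tendsto_averaging (v (G.owner n)) ω ⟨m.1, ⟨n, rfl⟩, m.2⟩ (hN m.1)
        (hd (G.owner n) m.1) ?_
      have hall : ∀ᶠ t in atTop, ∀ k : G.NonTerminal, G.OnPath m.1 k.1 →
          localStrategy (fun i => G.valuationSuperStrategy δ (v i) (firstRounds ω t)) k =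
            localStrategy (G.explore δ β) k :=
        eventually_all.2 fun k => by
          by_cases hmk : G.OnPath m.1 k.1
          · exact (ih m k hmk).mono fun _ h _ => h
          · exact Eventually.of_forall fun _ h => absurd h hmk
      -- Settled play throughout the subgame at `m` makes its continuation payoff equal to the limit
      -- value, not merely close to it.
      exact hall.mono fun t ht => G.expectedPayoff_congr _ _ ht
    have hlt : ∀ᶠ t in atTop, ∀ m : G.Move n, m ≠ best n →
        (G.averaging (v (G.owner n)) (firstRounds ω t)).at ⟨n, rfl⟩ m <
          (G.averaging (v (G.owner n)) (firstRounds ω t)).at ⟨n, rfl⟩ (best n) :=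
      eventually_all.2 fun m => by
        by_cases hm : m = best n
        · exact Eventually.of_forall fun _ h => absurd hm h
        · exact ((hlim m).eventually_lt (hlim (best n)) (hbest n m hm)).mono fun _ h _ => h
    filter_upwards [hlt] with t ht
    rw [localStrategy_valuation, myopic_eq_pure ht, ← hβ n]
    rfl

end Play

end ExtGame

end

theorem theorem4 {I V : Type*} [Finite I] [Fintype V] (G : ExtGame I V)
    (β : G.Profile) (hβ : G.IsPerfectEquilibrium β)
    (hβ_unique : ∀ β' : G.Profile, G.IsPerfectEquilibrium β' → β' = β) :
    ∃ δ₀ : ℝ, 0 < δ₀ ∧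
      ∀ (v : (i : I) → G.Valuation i) (δ : unitInterval), 0 < (δ : ℝ) → (δ : ℝ) < δ₀ →
        ∀ᵐ ω ∂(G.superPlay fun i => G.valuationSuperStrategy δ (v i)),
          ∃ T : ℕ, ∀ t : ℕ, T < t → ∀ (i : I) (n : G.NodeOf i) (m : G.Move n.1),
            (G.exploratory δ (G.averaging (v i) (ExtGame.firstRounds ω t)) n m).toReal =
              (1 - (δ : ℝ)) * (β i n m).toReal + (δ : ℝ) * (G.uniformStrategy i n m).toReal := by
  choose best hpure hstrict using G.exists_strict_max_of_unique hβ_unique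
  obtain ⟨δ₀, hδ₀, hlt⟩ := G.exists_forall_expectedPayoff_explore_lt hstrict
  refine ⟨δ₀, hδ₀, fun v δ hδ hδ' => ?_⟩
  filter_upwards [ae_all_iff.2 fun m => ExtGame.ae_tendsto_visitCount_onPath v hδ m,
    ae_all_iff.2 fun i => ae_all_iff.2 fun m => ExtGame.ae_tendsto_average_payoff
      (fun i => G.valuationSuperStrategy δ (v i)) i m] with ω hN hd
  have hev := Filter.eventually_all.2 fun n : G.NonTerminal =>
    ExtGame.eventually_localStrategy_eq hpure (hlt δ hδ') v ω hN
      (fun i m => hd i m (hN m)) n.1 n .refl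
  obtain ⟨T, hT⟩ := Filter.eventually_atTop.1 hev
  refine ⟨T, fun t ht i n m => ?_⟩
  -- Replaces `i` by the owner of `n`, so that both sides become local strategies at `n`.
  obtain ⟨n, rfl⟩ := n
  have h := congrArg (fun p : PMF (G.Move n) => (p m).toReal) (hT t ht.le n)
  exact h.trans (ExtGame.mix_apply_toReal δ _ _ m)
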